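/- For a positive integer $N$ let $X$ and $Y$ be independent random variables, each uniformly distributed on $\{1,\dots,N\}$. For discrete random variables $U,Z$ write $H(U)=-\sum_u \Pr[U=u]\log_2\Pr[U=u]$ (with $0\log_2 0=0$) for the Shannon entropy and $H(U\mid Z)=\sum_{z}\Pr[Z=z]\,H(U\mid Z=z)$ for the conditional entropy, where the sum is over the values $z$ with $\Pr[Z=z]>0$ and $H(U\mid Z=z)$ is the entropy of $U$ under the conditional probability given $Z=z$. Then, for every $N\ge 1$, $$H\bigl((X,Y)\mid X\cdot Y\bigr)=2\log_2 N-H(X\cdot Y),$$ and $$H\bigl((X,Y)\mid X\cdot Y\bigr)=\Theta(\log\log N)\qquad (N\to\infty),$$ that is, there are absolute constants $c,C>0$ and $N_0$ such that $c\log\log N\le H((X,Y)\mid X\cdot Y)\le C\log\log N$ for all $N\ge N_0$. -/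

import Mathlib

open MeasureTheory ProbabilityTheory

universe u

noncomputable section

/-- The Shannon entropy `H(X) = -∑ₛ Pr[X = s] log₂ Pr[X = s]`, in bits, of a discrete random
variable `X` under `μ`. (All random variables below take only finitely many values with positive
probability, so that the sum has finite support; `0 log₂ 0 = 0`.) -/
def shannonEntropy {Ω S : Type*} [MeasurableSpace Ω] (X : Ω → S) (μ : Measure Ω) : ℝ :=
  -∑' s : S, μ.real (X ⁻¹' {s}) * Real.logb 2 (μ.real (X ⁻¹' {s}))

/-- The conditional entropy (Shannon's equivocation)
`H(X | Z) = ∑_z Pr[Z = z] H(X | Z = z)`, where `H(X | Z = z)` is the entropy of `X` under the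
conditional probability given the event `Z = z`; values `z` of probability zero contribute zero. -/
def equivocation {Ω S T : Type*} [MeasurableSpace Ω] (X : Ω → S) (Z : Ω → T)
    (μ : Measure Ω) : ℝ :=
  ∑' z : T, μ.real (Z ⁻¹' {z}) * shannonEntropy X (ProbabilityTheory.cond μ (Z ⁻¹' {z}))

/-- `X` and `Y` are independent random variables, each uniformly distributed on `{1, …, N}`. -/
structure IsIndepUniformPair {Ω : Type*} [MeasurableSpace Ω] (μ : Measure Ω) (N : ℕ)
    (X Y : Ω → ℕ) : Prop where
  law_left : HasLaw X (uniformOn (Set.Icc 1 N)) μ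
  law_right : HasLaw Y (uniformOn (Set.Icc 1 N)) μ
  indep : IndepFun X Y μ

end

/-! Let r(n) be the number of factorizations n = xy with x, y ≤ N. Given XY = n the pair is uniform
on r(n) points, so the equivocation is the mean of log₂ r(xy) over the square
(`equivocation_of_hasLaw_uniformOn`).

Upper bound: r(xy) ≤ d(xy) ≤ d(x)d(y), and by Jensen the mean of log d is at most the log of the
mean of d, which is at most log(1 + log N).

Lower bound: write log r = log d − log(d/r). As d ≥ 2^ω and ω(xy) averages at least 2 log log N −
O(1) by Mertens, the first term contributes 2 log 2 · log log N. Summing d/r over the square counts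
each product n once with weight d(n), so by Jensen the second costs only log log N + O(1). Since 2
log 2 > 1, a positive multiple of log log N survives (`le_sum_log_factorPairCount`). -/

/-! ### Divisors and prime factors on average -/

open Finset in
theorem sum_inv_mul_sub_one_le (N : ℕ) :
    ∑ p ∈ Nat.primesBelow (N + 1), (1 : ℝ) / (p * (p - 1)) ≤ 1 := by
  have h : ∀ M : ℕ, ∑ k ∈ Ico 2 (M + 2), (1 : ℝ) / (k * (k - 1)) = 1 - 1 / (M + 1) := by
    intro M
    induction M with
    | zero => simp
    | succ M ih =>
      rw [show M + 1 + 2 = (M + 2) + 1 by ring, sum_Ico_succ_top (by omega), ih]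
      push_cast
      have h1 : (M : ℝ) + 1 ≠ 0 := by positivity
      have h2 : (M : ℝ) + 2 ≠ 0 := by positivity
      have h3 : (M : ℝ) + 2 - 1 = M + 1 := by ring
      have h4 : (M : ℝ) + 1 + 1 = M + 2 := by ring
      rw [h3, h4]
      field_simp
      ring
  calc ∑ p ∈ Nat.primesBelow (N + 1), (1 : ℝ) / (p * (p - 1))
      ≤ ∑ k ∈ Ico 2 (N + 2), (1 : ℝ) / (k * (k - 1)) := by
        refine sum_le_sum_of_subset_of_nonneg (fun p hp => ?_) fun k hk _ => ?_
        · have := (Nat.prime_of_mem_primesBelow hp).two_le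
          have := Nat.lt_of_mem_primesBelow hp
          simp; omega
        · have : (2 : ℝ) ≤ k := by exact_mod_cast (mem_Ico.1 hk).1
          have : (0 : ℝ) ≤ k * (k - 1) := mul_nonneg (by linarith) (by linarith)
          positivity
    _ ≤ 1 := by rw [h]; linarith [show (0 : ℝ) ≤ 1 / (N + 1) by positivity]

open Finset in
/-- The lower bound in Mertens' second theorem. -/
theorem log_log_sub_one_le_sum_primesBelow_inv {N : ℕ} (hN : 2 ≤ N) :
    Real.log (Real.log N) - 1 ≤ ∑ p ∈ Nat.primesBelow (N + 1), (1 : ℝ) / p := by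
  let f : ℕ →* ℝ :=
    { toFun := fun n => (n : ℝ)⁻¹, map_one' := by simp, map_mul' := fun a b => by simp [mul_comm] }
  have hf : ∀ n, f n = (n : ℝ)⁻¹ := fun n => rfl
  obtain ⟨hs, hp⟩ := EulerProduct.summable_and_hasSum_smoothNumbers_prod_primesBelow_geometric
    (f := f) (fun {p} hp => by
      rw [hf, norm_inv, Real.norm_natCast]
      exact inv_lt_one_of_one_lt₀ (by exact_mod_cast hp.one_lt)) (N + 1)
  -- The Euler product sums 1/n over all integers whose primes are at most N, hence dominates the
  -- harmonic sum.
  have hprod : Real.log N ≤ ∏ p ∈ Nat.primesBelow (N + 1), (1 - f p)⁻¹ := by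
    have h1 : Real.log N ≤ ∑ n ∈ Icc 1 N, (n : ℝ)⁻¹ := by
      refine le_trans ?_ (le_of_le_of_eq (log_add_one_le_harmonic N) ?_)
      · exact Real.log_le_log (by positivity) (by push_cast; linarith)
      · rw [harmonic_eq_sum_Icc]; push_cast; rfl
    -- The default value 1 is never taken on `Icc 1 N`.
    let e : ℕ → (N + 1).smoothNumbers := fun n =>
      if h : n ∈ (N + 1).smoothNumbers then ⟨n, h⟩ else ⟨1, Nat.mem_smoothNumbers.2 (by simp)⟩
    have he : ∀ n ∈ Icc 1 N, (e n : ℕ) = n := by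
      intro n hn
      have hm : n ∈ (N + 1).smoothNumbers :=
        Nat.mem_smoothNumbers_of_lt (by simp at hn; omega) (by simp at hn; omega)
      simp [e, hm]
    refine h1.trans ?_
    calc ∑ n ∈ Icc 1 N, (n : ℝ)⁻¹ = ∑ m ∈ (Icc 1 N).image e, f m := by
          rw [sum_image]
          · exact sum_congr rfl fun n hn => by rw [hf, he n hn]
          · intro a ha b hb hab
            rw [← he a ha, ← he b hb, hab]
      _ ≤ _ := sum_le_hasSum _ (fun m _ => by rw [hf]; positivity) hp
  have hlog : 0 < Real.log N := Real.log_pos (by exact_mod_cast hN)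
  have hpos : ∀ p ∈ Nat.primesBelow (N + 1), (2 : ℝ) ≤ p := fun p hp => by
    exact_mod_cast (Nat.prime_of_mem_primesBelow hp).two_le
  have h2 := Real.log_le_log hlog hprod
  rw [Real.log_prod] at h2
  · have h3 : ∑ p ∈ Nat.primesBelow (N + 1), Real.log ((1 - f p)⁻¹) ≤
        ∑ p ∈ Nat.primesBelow (N + 1), ((1 : ℝ) / p + 1 / (p * (p - 1))) := by
      refine sum_le_sum fun p hp => ?_
      have h2p := hpos p hp
      have hne : (p : ℝ) - 1 ≠ 0 := by linarith
      have hne' : (p : ℝ) ≠ 0 := by linarith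
      have hlt : (0 : ℝ) < 1 - (p : ℝ)⁻¹ := by
        have := inv_lt_one_of_one_lt₀ (show (1 : ℝ) < p by linarith)
        linarith
      rw [hf]
      -- log t ≤ t − 1 at t = (1 − 1/p)⁻¹ gives 1/(p − 1) = 1/p + 1/(p(p − 1)).
      refine (Real.log_le_sub_one_of_pos (inv_pos.2 hlt)).trans (le_of_eq ?_)
      have : (1 : ℝ) - (p : ℝ)⁻¹ = (p - 1) / p := by field_simp
      rw [this]
      field_simp
      ring
    rw [sum_add_distrib] at h3
    linarith [sum_inv_mul_sub_one_le N]
  · intro p hp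
    have := hpos p hp
    rw [hf]
    have := inv_lt_one_of_one_lt₀ (show (1 : ℝ) < p by linarith)
    exact inv_ne_zero (by linarith)

-- Count the pairs k ∣ n by k, then compare with the harmonic sum.
open Finset in
theorem sum_card_divisors_le (M : ℕ) :
    ∑ n ∈ Icc 1 M, (#n.divisors : ℝ) ≤ M * (1 + Real.log M) := by
  have h : ∑ n ∈ Icc 1 M, #n.divisors = ∑ k ∈ Icc 1 M, M / k := by
    calc ∑ n ∈ Icc 1 M, #n.divisors = ∑ n ∈ Icc 1 M, ∑ k ∈ Icc 1 M, if k ∣ n then 1 else 0 := by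
          refine sum_congr rfl fun n hn => ?_
          rw [← card_filter]
          congr 1
          ext k
          simp only [mem_Icc, Nat.mem_divisors, mem_filter] at hn ⊢
          constructor
          · rintro ⟨h1, h2⟩
            exact ⟨⟨Nat.pos_of_dvd_of_pos h1 (by omega), (Nat.le_of_dvd (by omega) h1).trans hn.2⟩, h1⟩
          · rintro ⟨-, h⟩
            exact ⟨h, by omega⟩
      _ = ∑ k ∈ Icc 1 M, M / k := by
          rw [sum_comm]
          refine sum_congr rfl fun k _ => ?_
          rw [← card_filter, ← Nat.Ioc_filter_dvd_card_eq_div]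
          rfl
  calc ∑ n ∈ Icc 1 M, (#n.divisors : ℝ) = ∑ k ∈ Icc 1 M, ((M / k : ℕ) : ℝ) := by exact_mod_cast h
    _ ≤ ∑ k ∈ Icc 1 M, (M : ℝ) * (k : ℝ)⁻¹ :=
        sum_le_sum fun k _ => by rw [← div_eq_mul_inv]; exact Nat.cast_div_le
    _ = M * (harmonic M : ℝ) := by rw [← mul_sum, harmonic_eq_sum_Icc]; push_cast; rfl
    _ ≤ _ := by gcongr; exact harmonic_le_one_add_log M

open Finset in
theorem two_pow_card_primeFactors_le_card_divisors {n : ℕ} (hn : n ≠ 0) :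
    2 ^ #n.primeFactors ≤ #n.divisors := by
  rw [Nat.card_divisors hn, ← prod_const]
  refine prod_le_prod' fun p hp => ?_
  have := (Nat.prime_of_mem_primeFactors hp).factorization_pos_of_dvd hn
    (Nat.dvd_of_mem_primeFactors hp)
  omega

open Finset in
/-- The average number of prime factors of a product of two integers up to `N`. -/
theorem le_sum_card_primeFactors_mul {N : ℕ} (hN : 2 ≤ N) :
    (N : ℝ) ^ 2 * (2 * Real.log (Real.log N) - 5) ≤
      ∑ z ∈ Icc 1 N ×ˢ Icc 1 N, (#(z.1 * z.2).primeFactors : ℝ) := by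
  set Q := Nat.primesBelow (N + 1) with hQ
  have hcard : ∀ x ∈ Icc 1 N, ∀ y ∈ Icc 1 N, (#(x * y).primeFactors : ℝ) =
      ∑ p ∈ Q, ((if p ∣ x then 1 else 0) + (if p ∣ y then 1 else 0)
        - (if p ∣ x then 1 else 0) * (if p ∣ y then 1 else 0)) := by
    intro x hx y hy
    rw [mem_Icc] at hx hy
    have h1 : (x * y).primeFactors = {p ∈ Q | p ∣ x ∨ p ∣ y} := by
      ext p
      rw [Nat.mem_primeFactors, mem_filter, hQ, Nat.mem_primesBelow]
      constructor
      · rintro ⟨hp, hd, -⟩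
        have hd := hp.dvd_mul.1 hd
        refine ⟨⟨?_, hp⟩, hd⟩
        rcases hd with h | h
        · exact Nat.lt_succ_of_le ((Nat.le_of_dvd (by omega) h).trans hx.2)
        · exact Nat.lt_succ_of_le ((Nat.le_of_dvd (by omega) h).trans hy.2)
      · rintro ⟨⟨-, hp⟩, hd⟩
        exact ⟨hp, hp.dvd_mul.2 hd, mul_ne_zero (by omega) (by omega)⟩
    rw [h1, card_filter]
    push_cast
    refine sum_congr rfl fun p _ => ?_
    by_cases ha : p ∣ x <;> by_cases hb : p ∣ y <;> simp [ha, hb]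
  have hcount : ∀ p : ℕ, ∑ x ∈ Icc 1 N, (if p ∣ x then (1 : ℝ) else 0) = (N / p : ℕ) := by
    intro p
    rw [← Nat.Ioc_filter_dvd_card_eq_div, card_filter]
    push_cast
    rfl
  have hsum : ∑ z ∈ Icc 1 N ×ˢ Icc 1 N, (#(z.1 * z.2).primeFactors : ℝ) =
      ∑ p ∈ Q, (2 * N * ((N / p : ℕ) : ℝ) - ((N / p : ℕ) : ℝ) ^ 2) := by
    rw [sum_product, sum_congr rfl fun x hx => sum_congr rfl (hcard x hx)]
    rw [sum_congr rfl fun x _ => sum_comm, sum_comm]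
    refine sum_congr rfl fun p _ => ?_
    simp only [sum_sub_distrib, sum_add_distrib, ← mul_sum, ← sum_mul, sum_const, hcount,
      Nat.card_Icc, nsmul_eq_mul]
    simp
    ring
  -- Total loss of 5: 2 from Mertens, 2 from the floors (at most N primes, 2N each), 1 from the
  -- squares.
  have hterm : ∀ p ∈ Q, (N : ℝ) ^ 2 * (2 * (1 / p)) - 2 * N - N ^ 2 * (1 / (p * (p - 1))) ≤
      2 * N * ((N / p : ℕ) : ℝ) - ((N / p : ℕ) : ℝ) ^ 2 := by
    intro p hp
    have h2 : (2 : ℝ) ≤ p := by exact_mod_cast (Nat.prime_of_mem_primesBelow hp).two_le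
    have hle : ((N / p : ℕ) : ℝ) ≤ N / p := Nat.cast_div_le
    have hge : (N : ℝ) / p - 1 ≤ ((N / p : ℕ) : ℝ) := by
      have h := Nat.lt_div_mul_add (a := N) (b := p) (by
        exact (Nat.prime_of_mem_primesBelow hp).pos)
      have h' : (N : ℝ) < ((N / p : ℕ) : ℝ) * p + p := by exact_mod_cast h
      rw [sub_le_iff_le_add, div_le_iff₀ (by linarith)]
      linarith
    have hsq : ((N / p : ℕ) : ℝ) ^ 2 ≤ N ^ 2 * (1 / (p * (p - 1))) := by
      calc ((N / p : ℕ) : ℝ) ^ 2 ≤ ((N : ℝ) / p) ^ 2 := by gcongr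
        _ = (N : ℝ) ^ 2 * (1 / (p * p)) := by field_simp
        _ ≤ _ := by
          gcongr
          · exact mul_pos (by linarith) (by linarith)
          · linarith
    have hlin := mul_le_mul_of_nonneg_left hge (show (0 : ℝ) ≤ 2 * N by positivity)
    have : 2 * (N : ℝ) * (N / p - 1) = N ^ 2 * (2 * (1 / p)) - 2 * N := by ring
    linarith
  rw [hsum]
  refine le_trans ?_ (sum_le_sum hterm)
  simp only [sum_sub_distrib, ← mul_sum, sum_const, nsmul_eq_mul]
  have hQc : (#Q : ℝ) ≤ N := by
    have : Q ⊆ Icc 1 N := fun p hp => by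
      have := (Nat.prime_of_mem_primesBelow hp).two_le
      have := Nat.lt_of_mem_primesBelow hp
      simp; omega
    simpa using card_le_card this
  have h1 := mul_le_mul_of_nonneg_left (log_log_sub_one_le_sum_primesBelow_inv hN)
    (show (0 : ℝ) ≤ N ^ 2 by positivity)
  have h2 := mul_le_mul_of_nonneg_left (sum_inv_mul_sub_one_le N)
    (show (0 : ℝ) ≤ N ^ 2 by positivity)
  have h3 := mul_le_mul_of_nonneg_right hQc (show (0 : ℝ) ≤ 2 * N by positivity)
  rw [← hQ] at h1 h2
  nlinarith

open Finset in
/-- Jensen's inequality for the logarithm, in the form of a bound on a sum. -/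
theorem sum_log_le {ι : Type*} (s : Finset ι) (g : ι → ℝ) (hg : ∀ i ∈ s, 0 < g i) {A : ℝ}
    (hA : 0 < A) (h : ∑ i ∈ s, g i ≤ #s * A) :
    ∑ i ∈ s, Real.log (g i) ≤ #s * Real.log A := by
  have h1 : ∀ i ∈ s, Real.log (g i) ≤ g i / A - 1 + Real.log A := fun i hi => by
    have := Real.log_le_sub_one_of_pos (div_pos (hg i hi) hA)
    rw [Real.log_div (hg i hi).ne' hA.ne'] at this
    linarith
  refine (sum_le_sum h1).trans ?_
  simp only [sum_add_distrib, sum_sub_distrib, ← sum_div, sum_const, nsmul_eq_mul, mul_one]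
  have : (∑ i ∈ s, g i) / A ≤ #s := by rwa [div_le_iff₀ hA]
  linarith

/-! ### Logarithmic averages of the number of factor pairs -/

/-- The number of ways to write `n` as a product of two integers between `1` and `N`. -/
def factorPairCount (N n : ℕ) : ℕ :=
  (((Finset.Icc 1 N) ×ˢ (Finset.Icc 1 N)).filter fun z => z.1 * z.2 = n).card

open Finset in
theorem factorPairCount_pos {N : ℕ} {z : ℕ × ℕ} (hz : z ∈ Icc 1 N ×ˢ Icc 1 N) :
    0 < factorPairCount N (z.1 * z.2) :=
  card_pos.2 ⟨z, mem_filter.2 ⟨hz, rfl⟩⟩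

open Finset in
theorem factorPairCount_le_card_divisors {N n : ℕ} (hn : n ≠ 0) :
    factorPairCount N n ≤ #n.divisors := by
  refine card_le_card_of_injOn Prod.fst (fun z hz => ?_) fun z hz w hw h => ?_
  · simp only [coe_filter, Set.mem_ofPred_eq] at hz
    exact Nat.mem_divisors.2 ⟨⟨z.2, hz.2.symm⟩, hn⟩
  · simp only [coe_filter, Set.mem_ofPred_eq, mem_product, mem_Icc] at hz hw
    refine Prod.ext h (Nat.eq_of_mul_eq_mul_left hz.1.1.1 ?_)
    rw [hz.2, h, hw.2]

-- Submultiplicativity of d separates the variables, so that Jensen applies to each alone.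
open Finset in
theorem sum_log_factorPairCount_le {N : ℕ} (hN : 1 ≤ N) :
    ∑ z ∈ Icc 1 N ×ˢ Icc 1 N, Real.log (factorPairCount N (z.1 * z.2)) ≤
      (N : ℝ) ^ 2 * (2 * Real.log (1 + Real.log N)) := by
  have hpos : ∀ x ∈ Icc 1 N, 0 < (#x.divisors : ℝ) := fun x hx => by
    exact_mod_cast card_pos.2 ⟨1, Nat.one_mem_divisors.2 (by simp at hx; omega)⟩
  have hA : 0 < 1 + Real.log N := by
    linarith [Real.log_nonneg (show (1 : ℝ) ≤ N by exact_mod_cast hN)]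
  have h1 : ∑ x ∈ Icc 1 N, Real.log #x.divisors ≤ N * Real.log (1 + Real.log N) := by
    have := sum_log_le (Icc 1 N) _ hpos hA (by simpa using sum_card_divisors_le N)
    simpa using this
  have h2 : ∀ z ∈ Icc 1 N ×ˢ Icc 1 N, Real.log (factorPairCount N (z.1 * z.2)) ≤
      Real.log #z.1.divisors + Real.log #z.2.divisors := by
    intro z hz
    have hr := factorPairCount_pos hz
    rw [mem_product] at hz
    rw [← Real.log_mul (hpos _ hz.1).ne' (hpos _ hz.2).ne']
    refine Real.log_le_log (by exact_mod_cast hr) ?_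
    norm_cast
    have hz' := hz
    simp only [mem_Icc] at hz'
    refine (factorPairCount_le_card_divisors (mul_ne_zero (by omega) (by omega))).trans ?_
    rw [Nat.divisors_mul]
    exact card_mul_le
  refine (sum_le_sum h2).trans ?_
  rw [sum_product]
  simp only [sum_add_distrib, sum_const, nsmul_eq_mul, ← mul_sum, Nat.card_Icc,
    Nat.add_sub_cancel]
  have := mul_le_mul_of_nonneg_left h1 (show (0 : ℝ) ≤ N by positivity)
  nlinarith

open Finset in
theorem le_sum_log_factorPairCount {N : ℕ} (hN : 2 ≤ N) :
    (N : ℝ) ^ 2 * (Real.log 2 * (2 * Real.log (Real.log N) - 5) - Real.log (1 + 2 * Real.log N)) ≤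
      ∑ z ∈ Icc 1 N ×ˢ Icc 1 N, Real.log (factorPairCount N (z.1 * z.2)) := by
  have hne : ∀ z ∈ Icc 1 N ×ˢ Icc 1 N, z.1 * z.2 ≠ 0 := fun z hz => by
    simp only [mem_product, mem_Icc] at hz
    exact mul_ne_zero (by omega) (by omega)
  have hr : ∀ z ∈ Icc 1 N ×ˢ Icc 1 N, 0 < (factorPairCount N (z.1 * z.2) : ℝ) := fun z hz => by
    exact_mod_cast factorPairCount_pos hz
  have hd : ∀ z ∈ Icc 1 N ×ˢ Icc 1 N, 0 < (#(z.1 * z.2).divisors : ℝ) := fun z hz => by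
    exact_mod_cast card_pos.2 ⟨1, Nat.one_mem_divisors.2 (hne z hz)⟩
  have hA : 0 < 1 + 2 * Real.log N := by
    linarith [Real.log_nonneg (show (1 : ℝ) ≤ N by exact_mod_cast (by omega : 1 ≤ N))]
  have hsum : ∑ z ∈ Icc 1 N ×ˢ Icc 1 N,
      (#(z.1 * z.2).divisors : ℝ) / factorPairCount N (z.1 * z.2) ≤
        #(Icc 1 N ×ˢ Icc 1 N) * (1 + 2 * Real.log N) := by
    have hmaps : ∀ z ∈ Icc 1 N ×ˢ Icc 1 N, z.1 * z.2 ∈ Icc 1 (N ^ 2) := fun z hz => by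
      have := hne z hz
      simp only [mem_product, mem_Icc] at hz ⊢
      exact ⟨by omega, by rw [sq]; exact Nat.mul_le_mul hz.1.2 hz.2.2⟩
    -- The fibre over n has r(n) points, which cancels the denominator.
    rw [← sum_fiberwise_of_maps_to hmaps]
    calc _ ≤ ∑ n ∈ Icc 1 (N ^ 2), (#n.divisors : ℝ) := by
          refine sum_le_sum fun n _ => ?_
          rw [sum_congr rfl (g := fun _ => (#n.divisors : ℝ) / factorPairCount N n)
            fun z hz => by rw [(mem_filter.1 hz).2], sum_const, nsmul_eq_mul]
          change (factorPairCount N n : ℝ) * _ ≤ _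
          rcases eq_or_ne (factorPairCount N n : ℝ) 0 with h | h
          · rw [h]; simp
          · rw [mul_div_cancel₀ _ h]
      _ ≤ _ := sum_card_divisors_le _
      _ = _ := by
          push_cast
          rw [Real.log_pow, card_product, Nat.card_Icc, Nat.add_sub_cancel]
          push_cast
          ring
  have h1 := sum_log_le _ _ (fun z hz => div_pos (hd z hz) (hr z hz)) hA hsum
  rw [sum_congr rfl fun z hz => Real.log_div (hd z hz).ne' (hr z hz).ne', sum_sub_distrib] at h1
  have h2 : Real.log 2 * ∑ z ∈ Icc 1 N ×ˢ Icc 1 N, (#(z.1 * z.2).primeFactors : ℝ) ≤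
      ∑ z ∈ Icc 1 N ×ˢ Icc 1 N, Real.log #(z.1 * z.2).divisors := by
    rw [mul_sum]
    refine sum_le_sum fun z hz => ?_
    rw [mul_comm, ← Real.log_pow]
    refine Real.log_le_log (by positivity) ?_
    exact_mod_cast two_pow_card_primeFactors_le_card_divisors (hne z hz)
  have h3 := mul_le_mul_of_nonneg_left (le_sum_card_primeFactors_mul hN)
    (Real.log_nonneg one_le_two)
  have h4 : (#(Icc 1 N ×ˢ Icc 1 N) : ℝ) = (N : ℝ) ^ 2 := by simp; ring
  rw [h4] at h1
  nlinarith

/-! ### Entropy of functions of a uniform variable -/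

section FiniteUniform

variable {Ω S T : Type*} [MeasurableSpace Ω] {μ : Measure Ω} [DecidableEq T]
  [MeasurableSpace S] [MeasurableSingletonClass S] [Countable S] {P : Finset S} {W : Ω → S}

open Finset in
theorem measureReal_preimage_of_hasLaw_uniformOn (hW : HasLaw W (uniformOn (P : Set S)) μ)
    (A : Set S) [DecidablePred (· ∈ A)] : μ.real (W ⁻¹' A) = #{z ∈ P | z ∈ A} / #P := by
  classical
  have hA : MeasurableSet A := A.to_countable.measurableSet
  have h : μ (W ⁻¹' A) = #{z ∈ P | z ∈ A} / #P := by
    rw [← Measure.map_apply_of_aemeasurable hW.aemeasurable hA, hW.map_eq,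
      ← uniformOn_inter_self P.finite_toSet]
    have : (P : Set S) ∩ A = (({z ∈ P | z ∈ A} : Finset S) : Set S) := by ext; simp
    rw [this, uniformOn_apply_finset, inter_eq_right.2 (filter_subset _ _)]
  simp [measureReal_def, h]

open Finset in
theorem measureReal_preimage_comp_singleton (hW : HasLaw W (uniformOn (P : Set S)) μ)
    (f : S → T) (t : T) :
    μ.real ((fun ω => f (W ω)) ⁻¹' {t}) = #{z ∈ P | f z = t} / #P := by
  classical
  have := measureReal_preimage_of_hasLaw_uniformOn hW (f ⁻¹' {t})
  rw [← Set.preimage_comp] at this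
  refine this.trans ?_
  congr 3
  ext z
  simp

-- Conditioning leaves W uniform on the fibre. For an empty fibre both sides are 0.
open Finset in
theorem shannonEntropy_cond_of_hasLaw_uniformOn (hW : HasLaw W (uniformOn (P : Set S)) μ)
    (f : S → T) (t : T) :
    shannonEntropy W (ProbabilityTheory.cond μ ((fun ω => f (W ω)) ⁻¹' {t})) =
      Real.logb 2 #{z ∈ P | f z = t} := by
  classical
  set F := P.filter fun z => f z = t with hF
  have hE : NullMeasurableSet ((fun ω => f (W ω)) ⁻¹' {t}) μ :=
    hW.aemeasurable.nullMeasurable (f ⁻¹' {t}).to_countable.measurableSet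
  have hcond : ∀ s : S, (ProbabilityTheory.cond μ ((fun ω => f (W ω)) ⁻¹' {t})).real (W ⁻¹' {s}) =
      if s ∈ F then (#F : ℝ)⁻¹ else 0 := by
    intro s
    have hinter : W ⁻¹' {s} ∩ (fun ω => f (W ω)) ⁻¹' {t} = W ⁻¹' ({s} ∩ f ⁻¹' {t}) := rfl
    have hset : #{z ∈ P | z ∈ ({s} ∩ f ⁻¹' {t} : Set S)} = if s ∈ F then 1 else 0 := by
      split_ifs with h
      · rw [card_eq_one]
        refine ⟨s, ?_⟩
        ext z
        simp only [hF, mem_filter] at h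
        simp only [mem_filter, Set.mem_inter_iff, Set.mem_singleton_iff, Set.mem_preimage,
          mem_singleton]
        exact ⟨fun h => h.2.1, by rintro rfl; exact ⟨h.1, rfl, h.2⟩⟩
      · rw [card_eq_zero, filter_eq_empty_iff]
        rintro z hz ⟨rfl, hzt⟩
        exact h (mem_filter.2 ⟨hz, hzt⟩)
    have hreal : (ProbabilityTheory.cond μ ((fun ω => f (W ω)) ⁻¹' {t})).real (W ⁻¹' {s}) =
        (μ.real ((fun ω => f (W ω)) ⁻¹' {t}))⁻¹ *
          μ.real (W ⁻¹' {s} ∩ (fun ω => f (W ω)) ⁻¹' {t}) := by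
      simp [measureReal_def, ProbabilityTheory.cond, Measure.restrict_apply₀' hE]
    rw [hreal, hinter, measureReal_preimage_comp_singleton hW,
      measureReal_preimage_of_hasLaw_uniformOn hW, hset]
    split_ifs with h
    · have : (#P : ℝ) ≠ 0 := by
        exact_mod_cast (card_pos.2 ⟨s, (mem_filter.1 h).1⟩).ne'
      field_simp
      simp [hF]
    · simp
  rw [shannonEntropy, tsum_eq_sum (s := F) fun s hs => by rw [hcond, if_neg hs, zero_mul],
    sum_congr rfl fun s hs => by rw [hcond, if_pos hs], sum_const, nsmul_eq_mul, Real.logb_inv]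
  rcases eq_or_ne (#F : ℝ) 0 with h | h
  · simp [h]
  · field_simp

open Finset in
theorem equivocation_of_hasLaw_uniformOn (hW : HasLaw W (uniformOn (P : Set S)) μ) (f : S → T) :
    equivocation W (fun ω => f (W ω)) μ =
      (∑ z ∈ P, Real.logb 2 #{w ∈ P | f w = f z}) / #P := by
  rw [equivocation]
  simp only [shannonEntropy_cond_of_hasLaw_uniformOn hW, measureReal_preimage_comp_singleton hW]
  rw [tsum_eq_sum (s := P.image f), sum_div,
    ← sum_fiberwise_of_maps_to (fun z hz => mem_image_of_mem f hz)]
  · refine sum_congr rfl fun t _ => ?_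
    rw [sum_congr rfl (g := fun _ => Real.logb 2 #{w ∈ P | f w = t} / #P)
      fun z hz => by rw [(mem_filter.1 hz).2], sum_const, nsmul_eq_mul]
    ring
  · intro t ht
    rw [filter_eq_empty_iff.2 fun z hz hzt => ht (mem_image.2 ⟨z, hz, hzt⟩)]
    simp

-- Each point of the fibre F over t carries −log₂(#F/#P) = log₂ #P − log₂ #F with weight 1/#P.
open Finset in
theorem shannonEntropy_comp_of_hasLaw_uniformOn (hW : HasLaw W (uniformOn (P : Set S)) μ)
    (hP : P.Nonempty) (f : S → T) :
    shannonEntropy (fun ω => f (W ω)) μ =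
      Real.logb 2 #P - (∑ z ∈ P, Real.logb 2 #{w ∈ P | f w = f z}) / #P := by
  have hP0 : (#P : ℝ) ≠ 0 := by exact_mod_cast (card_pos.2 hP).ne'
  rw [shannonEntropy]
  simp only [measureReal_preimage_comp_singleton hW]
  have h : Real.logb 2 #P - (∑ z ∈ P, Real.logb 2 #{w ∈ P | f w = f z}) / #P =
      ∑ z ∈ P, (Real.logb 2 #P - Real.logb 2 #{w ∈ P | f w = f z}) / #P := by
    rw [← sum_div, sum_sub_distrib, sum_const, nsmul_eq_mul]
    field_simp
  rw [h, tsum_eq_sum (s := P.image f),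
    ← sum_fiberwise_of_maps_to (fun z hz => mem_image_of_mem f hz), ← sum_neg_distrib]
  · refine sum_congr rfl fun t ht => ?_
    obtain ⟨w, hw, hwt⟩ := mem_image.1 ht
    have h0 : (#{w ∈ P | f w = t} : ℝ) ≠ 0 := by
      exact_mod_cast (card_pos.2 ⟨w, mem_filter.2 ⟨hw, hwt⟩⟩).ne'
    rw [sum_congr rfl (g := fun _ => (Real.logb 2 #P - Real.logb 2 #{w ∈ P | f w = t}) / #P)
      fun z hz => by rw [(mem_filter.1 hz).2], sum_const, nsmul_eq_mul, Real.logb_div h0 hP0]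
    ring
  · intro t ht
    rw [filter_eq_empty_iff.2 fun z hz hzt => ht (mem_image.2 ⟨z, hz, hzt⟩)]
    simp

end FiniteUniform

/-! ### The product of two independent uniform integers -/

open Finset in
theorem IsIndepUniformPair.hasLaw_prodMk {Ω : Type*} [MeasurableSpace Ω] {μ : Measure Ω}
    [IsProbabilityMeasure μ] {N : ℕ} {X Y : Ω → ℕ} (h : IsIndepUniformPair μ N X Y) :
    HasLaw (fun ω => (X ω, Y ω))
      (uniformOn ((Icc 1 N ×ˢ Icc 1 N : Finset (ℕ × ℕ)) : Set (ℕ × ℕ))) μ where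
  aemeasurable := h.law_left.aemeasurable.prodMk h.law_right.aemeasurable
  map_eq := by
    rw [(indepFun_iff_map_prod_eq_prod_map_map h.law_left.aemeasurable
      h.law_right.aemeasurable).1 h.indep, h.law_left.map_eq, h.law_right.map_eq]
    refine Measure.ext_of_singleton fun z => ?_
    obtain ⟨x, y⟩ := z
    rw [← Set.singleton_prod_singleton, Measure.prod_prod, Set.singleton_prod_singleton,
      ← coe_Icc, ← coe_singleton, ← coe_singleton, ← coe_singleton, uniformOn_apply_finset,
      uniformOn_apply_finset, uniformOn_apply_finset, ← singleton_product_singleton,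
      product_inter_product, card_product, card_product, ENNReal.div_eq_inv_mul,
      ENNReal.div_eq_inv_mul, ENNReal.div_eq_inv_mul]
    push_cast
    rw [ENNReal.mul_inv (by simp) (by simp)]
    ring

open Finset in
theorem IsIndepUniformPair.equivocation_mul_eq {Ω : Type*} [MeasurableSpace Ω] {μ : Measure Ω}
    [IsProbabilityMeasure μ] {N : ℕ} {X Y : Ω → ℕ} (h : IsIndepUniformPair μ N X Y) :
    equivocation (fun ω => (X ω, Y ω)) (fun ω => X ω * Y ω) μ =
      (∑ z ∈ Icc 1 N ×ˢ Icc 1 N, Real.log (factorPairCount N (z.1 * z.2))) /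
        Real.log 2 / (N : ℝ) ^ 2 := by
  refine (equivocation_of_hasLaw_uniformOn h.hasLaw_prodMk fun z => z.1 * z.2).trans ?_
  rw [sum_div (f := fun z : ℕ × ℕ => Real.log (factorPairCount N (z.1 * z.2))), card_product,
    Nat.card_Icc, Nat.add_sub_cancel, Nat.cast_mul, sq]
  rfl

open Finset in
theorem IsIndepUniformPair.equivocation_mul_eq_sub {Ω : Type*} [MeasurableSpace Ω]
    {μ : Measure Ω} [IsProbabilityMeasure μ] {N : ℕ} (hN : 1 ≤ N) {X Y : Ω → ℕ}
    (h : IsIndepUniformPair μ N X Y) :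
    equivocation (fun ω => (X ω, Y ω)) (fun ω => X ω * Y ω) μ =
      2 * Real.logb 2 (N : ℝ) - shannonEntropy (fun ω => X ω * Y ω) μ := by
  have h1 := equivocation_of_hasLaw_uniformOn h.hasLaw_prodMk fun z => z.1 * z.2
  have h2 := shannonEntropy_comp_of_hasLaw_uniformOn h.hasLaw_prodMk
    ⟨(1, 1), by simpa using hN⟩ fun z => z.1 * z.2
  have h3 : Real.logb 2 (#(Icc 1 N ×ˢ Icc 1 N) : ℝ) = 2 * Real.logb 2 N := by
    rw [card_product, Nat.card_Icc, Nat.add_sub_cancel, Nat.cast_mul, ← sq, Real.logb_pow]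
    norm_num
  rw [← h1, h3] at h2
  linarith

theorem IsIndepUniformPair.equivocation_mul_le {Ω : Type*} [MeasurableSpace Ω] {μ : Measure Ω}
    [IsProbabilityMeasure μ] {N : ℕ} (hN : 1 ≤ N) {X Y : Ω → ℕ}
    (h : IsIndepUniformPair μ N X Y) :
    equivocation (fun ω => (X ω, Y ω)) (fun ω => X ω * Y ω) μ ≤
      2 * Real.log (1 + Real.log N) / Real.log 2 := by
  have hN' : (0 : ℝ) < N ^ 2 := by positivity
  rw [h.equivocation_mul_eq, div_le_iff₀ hN', div_mul_eq_mul_div, mul_comm _ ((N : ℝ) ^ 2)]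
  have := Real.log_pos one_lt_two
  gcongr
  exact sum_log_factorPairCount_le hN

theorem IsIndepUniformPair.le_equivocation_mul {Ω : Type*} [MeasurableSpace Ω] {μ : Measure Ω}
    [IsProbabilityMeasure μ] {N : ℕ} (hN : 2 ≤ N) {X Y : Ω → ℕ}
    (h : IsIndepUniformPair μ N X Y) :
    2 * Real.log (Real.log N) - 5 - Real.log (1 + 2 * Real.log N) / Real.log 2 ≤
      equivocation (fun ω => (X ω, Y ω)) (fun ω => X ω * Y ω) μ := by
  have hN' : (0 : ℝ) < N ^ 2 := by positivity
  have h2 := Real.log_pos one_lt_two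
  rw [h.equivocation_mul_eq, le_div_iff₀ hN', le_div_iff₀ h2]
  refine le_of_eq_of_le ?_ (le_sum_log_factorPairCount hN)
  field_simp

theorem mainTheorem1 :
    (∀ N : ℕ, 1 ≤ N → ∀ (Ω : Type u) [MeasurableSpace Ω] (μ : Measure Ω) [IsProbabilityMeasure μ]
      (X Y : Ω → ℕ), IsIndepUniformPair μ N X Y →
        equivocation (fun ω => (X ω, Y ω)) (fun ω => X ω * Y ω) μ =
          2 * Real.logb 2 (N : ℝ) - shannonEntropy (fun ω => X ω * Y ω) μ) ∧
    (∃ c C : ℝ, 0 < c ∧ 0 < C ∧ ∃ N₀ : ℕ, ∀ N : ℕ, N₀ ≤ N →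
      ∀ (Ω : Type u) [MeasurableSpace Ω] (μ : Measure Ω) [IsProbabilityMeasure μ]
        (X Y : Ω → ℕ), IsIndepUniformPair μ N X Y →
          c * Real.log (Real.log (N : ℝ)) ≤
              equivocation (fun ω => (X ω, Y ω)) (fun ω => X ω * Y ω) μ ∧
            equivocation (fun ω => (X ω, Y ω)) (fun ω => X ω * Y ω) μ ≤
              C * Real.log (Real.log (N : ℝ))) := by
  refine ⟨fun N hN Ω _ μ _ X Y h => h.equivocation_mul_eq_sub hN,
    1 / 10, 6, by norm_num, by norm_num, ?_⟩
  have hlim : Filter.Tendsto (fun N : ℕ => Real.log (Real.log (N : ℝ))) Filter.atTop Filter.atTop :=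
    Real.tendsto_log_atTop.comp (Real.tendsto_log_atTop.comp tendsto_natCast_atTop_atTop)
  obtain ⟨N₀, hN₀⟩ := Filter.eventually_atTop.1
    -- With L = log log N and log 2 ≥ 2/3 the bounds become L/2 − 8 and 3(1 + L). Here L ≥ 20 is
    -- exactly what L/2 − 8 ≥ L/10 needs.
    ((hlim.eventually_ge_atTop 20).and (Filter.eventually_ge_atTop 2))
  refine ⟨N₀, fun N hN Ω _ μ _ X Y h => ?_⟩
  obtain ⟨hL, hN2⟩ := hN₀ N hN
  have hlog0 : 0 ≤ Real.log N := Real.log_natCast_nonneg N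
  have hlog1 : 1 ≤ Real.log N := by
    by_contra! hlt
    linarith [Real.log_nonpos hlog0 hlt.le]
  have hlog2 : 2 / 3 ≤ Real.log 2 := by linarith [Real.log_two_gt_d9]
  have hpos2 : 0 < Real.log 2 := by linarith
  constructor
  · refine le_trans ?_ (h.le_equivocation_mul hN2)
    have h1 : Real.log (1 + 2 * Real.log N) ≤ 2 + Real.log (Real.log N) := by
      calc Real.log (1 + 2 * Real.log N) ≤ Real.log (3 * Real.log N) :=
            Real.log_le_log (by linarith) (by linarith)
        _ = Real.log 3 + Real.log (Real.log N) := Real.log_mul (by norm_num) (by linarith)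
        _ ≤ _ := by linarith [Real.log_le_sub_one_of_pos (show (0 : ℝ) < 3 by norm_num)]
    have h2 : Real.log (1 + 2 * Real.log N) / Real.log 2 ≤
        3 / 2 * (2 + Real.log (Real.log N)) := by
      rw [div_le_iff₀ hpos2]
      nlinarith
    linarith
  · refine (h.equivocation_mul_le (by omega)).trans ?_
    have h1 : Real.log (1 + Real.log N) ≤ 1 + Real.log (Real.log N) := by
      calc Real.log (1 + Real.log N) ≤ Real.log (2 * Real.log N) :=
            Real.log_le_log (by linarith) (by linarith)
        _ = Real.log 2 + Real.log (Real.log N) := Real.log_mul (by norm_num) (by linarith)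
        _ ≤ _ := by linarith [Real.log_le_sub_one_of_pos (show (0 : ℝ) < 2 by norm_num)]
    rw [div_le_iff₀ hpos2]
    nlinarith
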